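/- All logarithms $\log$ are to base $2$, and $h(x)=-x\log x-(1-x)\log(1-x)$ on $[0,1]$, with $0\log 0=0$. Let $V=V_1\cup V_2$ be a set of $n$ vertices ($n$ even), partitioned into two parts with $|V_1|=|V_2|=n/2$. For $p,q\in[0,1]$ let $\mathcal G(n,p,q)$ be the random graph on $V$ in which every pair of distinct vertices inside $V_1$ or inside $V_2$ is an edge with probability $p$, every pair with one vertex in $V_1$ and the other in $V_2$ is an edge with probability $q$, and all these events are mutually independent; write $P(G)$ for the probability of a labelled graph $G$. Two graphs $G,G'$ on $V$ are equivalent if there is an isomorphism $\phi$ from $G$ to $G'$ with $\phi(V_1)=V_1$ and $\phi(V_2)=V_2$; the equivalence classes $S$ are called partitioned structures, and $P(S)=\sum_{G\in S}P(G)$. The partitioned structural entropy of $\mathcal G(n,p,q)$ is $H_{\mathcal S}=-\sum_S P(S)\log P(S)$. **Theorem.** Let $p=p(n)$ and $q=q(n)$ in $[0,1]$ satisfy $n^{-1}\ln n\ll p$, $n^{-1}\ln n\ll q$ and $1-p\gg n^{-1}\ln n$ as $n\to\infty$ through the even integers (where $a\ll b$ means $a=o(b)$). Then: (i) There is $\alpha>0$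 such that, as $n\to\infty$ through the even integers, $$H_{\mathcal S}=2\binom{n/2}{2}h(p)+\frac{n^2}{4}h(q)-2\log\left(\frac n2\right)!+O\left(\frac{\log n}{n^{\alpha}}\right).$$ (ii) For every $\varepsilon>0$ and all sufficiently large even $n$, a random partitioned structure $S$, drawn with probability $P(S)$, satisfies $$P\left(\left|-\frac{1}{\binom n2}\log P(S)-\frac{n-2}{2n-2}h(p)-\frac{n}{2n-2}h(q)+\frac{2\log (n/2)!}{\binom n2}\right|<3\varepsilon\right)>1-4\varepsilon.$$ -/

import Mathlib

open Filter Asymptotics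

/-- `φ` is a partition-respecting isomorphism: the partition of `V` is given by the map
`c : V → ι` (the parts are the fibres of `c`), and the graph isomorphism `φ` maps every
part onto itself. -/
def PartitionIsomorphic {V ι : Type*} (c : V → ι) (G G' : SimpleGraph V) : Prop :=
  ∃ φ : G ≃g G', ∀ v, c (φ v) = c v

/-- Partition-respecting isomorphism, as an equivalence relation on the labelled graphs on `V`. -/
def partitionSetoid {V ι : Type*} (c : V → ι) : Setoid (SimpleGraph V) where
  r := PartitionIsomorphic c
  iseqv :=
    { refl := fun _ => ⟨SimpleGraph.Iso.refl, fun _ => rfl⟩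
      symm := by
        rintro G G' ⟨φ, hφ⟩
        refine ⟨φ.symm, fun v => ?_⟩
        have h := hφ (φ.symm v)
        rw [RelIso.apply_symm_apply] at h
        exact h.symm
      trans := by
        rintro G G' G'' ⟨φ, hφ⟩ ⟨ψ, hψ⟩
        exact ⟨φ.trans ψ, fun v => (hψ (φ v)).trans (hφ v)⟩ }

/-- Partitioned unlabelled graphs: the classes of labelled graphs on `V` under
partition-respecting isomorphism. -/
abbrev PartitionedStructure {V ι : Type*} (c : V → ι) : Type _ :=
  Quotient (partitionSetoid c)

noncomputable instance fintypePartitionedStructure {V ι : Type*} [Fintype V] (c : V → ι) :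
    Fintype (PartitionedStructure c) :=
  Fintype.ofFinite _

/-- The probability that the pair `e` is an edge of the stochastic block model: `p` if both
ends lie in the same part and `q` otherwise. -/
noncomputable def blockEdgeProb {V ι : Type*} (c : V → ι) (p q : unitInterval) (e : Sym2 V) :
    unitInterval :=
  open scoped Classical in if (e.map c).IsDiag then p else q

theorem blockEdgeProb_mk {V ι : Type*} (c : V → ι) (p q : unitInterval) (u v : V) :
    blockEdgeProb c p q s(u, v) = open scoped Classical in if c u = c v then p else q := by
  unfold blockEdgeProb
  by_cases h : c u = c v <;> simp [h]

open scoped Classical in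
/-- The probability of the labelled graph `G` when the pairs `e` of distinct vertices
are independently present with probability `blockEdgeProb c p q e`. -/
noncomputable def blockMass {V ι : Type*} [Fintype V] (c : V → ι) (p q : unitInterval)
    (G : SimpleGraph V) : ENNReal :=
  ∏ e : Sym2 V with ¬ e.IsDiag,
    if e ∈ G.edgeSet then ENNReal.ofReal (blockEdgeProb c p q e)
    else ENNReal.ofReal (1 - blockEdgeProb c p q e)

open scoped Classical in
theorem sum_blockMass {V ι : Type*} [Fintype V] (c : V → ι) (p q : unitInterval) :
    ∑ G : SimpleGraph V, blockMass c p q G = 1 := by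
  have h1 : ∀ e : Sym2 V, ENNReal.ofReal (blockEdgeProb c p q e)
      + ENNReal.ofReal (1 - blockEdgeProb c p q e) = 1 := by
    intro e
    rw [← ENNReal.ofReal_add (blockEdgeProb c p q e).2.1
      (sub_nonneg.2 (blockEdgeProb c p q e).2.2)]
    simp
  have h2 := Finset.prod_add (fun e : Sym2 V => ENNReal.ofReal (blockEdgeProb c p q e))
    (fun e => ENNReal.ofReal (1 - blockEdgeProb c p q e))
    (Finset.univ.filter fun e : Sym2 V => ¬ e.IsDiag)
  simp only [h1, Finset.prod_const_one] at h2
  rw [h2]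
  refine Finset.sum_bij' (fun G _ => G.edgeFinset)
    (fun t _ => SimpleGraph.fromEdgeSet (t : Set (Sym2 V))) ?_ ?_ ?_ ?_ ?_
  · intro G _
    rw [Finset.mem_powerset]
    intro e he
    simp only [Finset.mem_filter, Finset.mem_univ, true_and]
    exact G.not_isDiag_of_mem_edgeSet (SimpleGraph.mem_edgeFinset.1 he)
  · intro t _
    exact Finset.mem_univ _
  · intro G _
    simp
  · intro t ht
    rw [Finset.mem_powerset] at ht
    ext e
    simp only [SimpleGraph.mem_edgeFinset, SimpleGraph.edgeSet_fromEdgeSet]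
    constructor
    · intro h
      exact h.1
    · intro h
      exact ⟨h, (Finset.mem_filter.1 (ht h)).2⟩
  · intro G _
    have hsub : G.edgeFinset ⊆ Finset.univ.filter fun e : Sym2 V => ¬ e.IsDiag := by
      intro e he
      simp only [Finset.mem_filter, Finset.mem_univ, true_and]
      exact G.not_isDiag_of_mem_edgeSet (SimpleGraph.mem_edgeFinset.1 he)
    rw [blockMass, Finset.prod_ite]
    congr 1
    · refine Finset.prod_congr ?_ fun _ _ => rfl
      ext e
      simp only [Finset.mem_filter, SimpleGraph.mem_edgeFinset]
      exact ⟨fun h => h.2, fun h => ⟨Finset.mem_filter.1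
        (hsub (SimpleGraph.mem_edgeFinset.2 h)), h⟩⟩
    · refine Finset.prod_congr ?_ fun _ _ => rfl
      ext e
      simp

/-- The stochastic block model on the vertex set `V` partitioned by `c`, as a probability
distribution on the labelled graphs on `V`. -/
noncomputable def stochasticBlockModel {V ι : Type*} [Fintype V] (c : V → ι)
    (p q : unitInterval) : PMF (SimpleGraph V) :=
  open scoped Classical in PMF.ofFintype (blockMass c p q) (sum_blockMass c p q)

/-- The distribution of the partitioned unlabelled graph of a stochastic block model:
`P(S)` is the sum of `P(G)` over the labelled graphs `G` in the class `S`. -/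
noncomputable def structureLaw {V ι : Type*} [Fintype V] (c : V → ι)
    (p q : unitInterval) : PMF (PartitionedStructure c) :=
  (stochasticBlockModel c p q).map (Quotient.mk (partitionSetoid c))

/-- The Shannon entropy, in bits, of a probability distribution on a finite type. -/
noncomputable def shannonEntropy {α : Type*} [Fintype α] (μ : PMF α) : ℝ :=
  -∑ x, (μ x).toReal * Real.logb 2 (μ x).toReal

/-- The partitioned structural entropy of the stochastic block model. -/
noncomputable def partitionedStructuralEntropy {V ι : Type*} [Fintype V] (c : V → ι)
    (p q : unitInterval) : ℝ :=
  shannonEntropy (structureLaw c p q)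

/-- The binary entropy function, in bits. -/
noncomputable def binaryEntropyBits (x : ℝ) : ℝ :=
  -x * Real.logb 2 x - (1 - x) * Real.logb 2 (1 - x)

/-- `c` splits the `n`-element vertex set `V` into two parts of size `n / 2` each. -/
def IsBalancedBipartition {V : Type*} (n : ℕ) (c : V → Fin 2) : Prop :=
  Nat.card V = n ∧ ∀ i, 2 * Nat.card {v // c v = i} = n

/-! Let m = n/2. All labelled graphs in a class have the same probability, and by orbit counting the
class of G has (m!)² / |Aut G| members, where Aut G is the group of part-preserving automorphisms.
Hence -log P(S) = I(G) - 2 log m! + log |Aut G|, where I(G) is the self-information of G, a sum of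
independent terms, one per pair (`neg_logb_structureLaw`).

For (i), take expectations: I(G) contributes the entropies h(p), h(q) of the pairs, and the whole
error is E log |Aut G|, which lies between 0 and (E|Aut G| - 1)/ln 2. A permutation moving k
vertices moves about km/2 or more pairs inside the parts, and at least a third of them form a set T
disjoint from its image. Under an automorphism the pairs of T copy pairs outside T, which has
probability at most (1-s)^|T| when s ≤ min(p, 1-p) (`sum_graphWeight_mapsGraph_le`). With s = 72 ln
n / n this is at most n^(-3k), and summing over all permutations gives E|Aut G| ≤ (1 + n⁻²)^n ≤ 1 +
2/n. So α = 1 works.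

For (ii), Chebyshev's inequality controls I(G), since each pair has variance bounded independently
of p and q (`sum_pairWeight_mul_sq_le`). The crude bound log |Aut G| ≤ 2 log m! = o(n²) suffices for
the remaining term. -/

/-! ### Moments and atoms of finite product measures -/

/-- The total mass of a product weight factorizes. -/
theorem sum_prod_apply {E β : Type*} [Fintype E] [DecidableEq E] [Fintype β]
    (f : E → β → ℝ) : ∑ ω : E → β, ∏ e, f e (ω e) = ∏ e, ∑ b, f e b := by
  rw [Finset.prod_univ_sum, Fintype.piFinset_univ]

theorem sum_prod_mul_apply {E β : Type*} [Fintype E] [DecidableEq E] [Fintype β]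
    {μ : E → β → ℝ} (hμ : ∀ e, ∑ b, μ e b = 1) (i : E) (g : β → ℝ) :
    ∑ ω : E → β, (∏ e, μ e (ω e)) * g (ω i) = ∑ b, μ i b * g b := by
  -- The observable is absorbed into the factor at `i`; every other factor sums to 1.
  have h := sum_prod_apply fun e b => μ e b * (if e = i then g b else 1)
  simp only [Finset.prod_mul_distrib] at h
  have h1 : ∀ ω : E → β, ∏ e, (if e = i then g (ω e) else 1) = g (ω i) := fun ω => by
    rw [Finset.prod_ite_eq' Finset.univ i]; simp
  simp only [h1] at h
  rw [h, Finset.prod_eq_single i]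
  · simp
  · intro e _ he
    simp [he, hμ]
  · simp

/-- Linearity of the expectation under a product weight. -/
theorem sum_prod_mul_sum {E β : Type*} [Fintype E] [DecidableEq E] [Fintype β]
    {μ : E → β → ℝ} (hμ : ∀ e, ∑ b, μ e b = 1) (f : E → β → ℝ) :
    ∑ ω : E → β, (∏ e, μ e (ω e)) * ∑ i, f i (ω i) = ∑ i, ∑ b, μ i b * f i b := by
  simp only [Finset.mul_sum]
  rw [Finset.sum_comm]
  exact Finset.sum_congr rfl fun i _ => sum_prod_mul_apply hμ i (f i)

theorem sum_prod_mul_apply_mul_apply {E β : Type*} [Fintype E] [DecidableEq E] [Fintype β]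
    {μ : E → β → ℝ} {i j : E} (hij : i ≠ j) {g k : β → ℝ}
    (hg : ∑ b, μ i b * g b = 0) :
    ∑ ω : E → β, (∏ e, μ e (ω e)) * (g (ω i) * k (ω j)) = 0 := by
  have h := sum_prod_apply fun e b =>
    μ e b * ((if e = i then g b else 1) * (if e = j then k b else 1))
  simp only [Finset.prod_mul_distrib] at h
  have h1 : ∀ (i : E) (g : β → ℝ) (ω : E → β),
      ∏ e, (if e = i then g (ω e) else 1) = g (ω i) := fun i g ω => by
    rw [Finset.prod_ite_eq' Finset.univ i]; simp
  simp only [h1] at h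
  rw [h]
  refine Finset.prod_eq_zero (Finset.mem_univ i) ?_
  simpa [hij] using hg

/-- The variance of a sum of independent centred variables is the sum of the variances. -/
theorem sum_prod_mul_sum_sq {E β : Type*} [Fintype E] [DecidableEq E] [Fintype β]
    {μ : E → β → ℝ} (hμ : ∀ e, ∑ b, μ e b = 1) (f : E → β → ℝ)
    (hf : ∀ e, ∑ b, μ e b * f e b = 0) :
    ∑ ω : E → β, (∏ e, μ e (ω e)) * (∑ i, f i (ω i)) ^ 2 = ∑ i, ∑ b, μ i b * f i b ^ 2 := by
  simp only [sq, Finset.sum_mul_sum]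
  simp only [Finset.mul_sum]
  rw [Finset.sum_comm]
  refine Finset.sum_congr rfl fun i _ => ?_
  rw [Finset.sum_comm, Finset.sum_eq_single i]
  · exact sum_prod_mul_apply hμ i fun b => f i b * f i b
  · intro j _ hj
    exact sum_prod_mul_apply_mul_apply hj.symm (hf i)
  · simp

/-- A set of configurations that are determined by their values off `T` has small mass when
the marginals on `T` have no large atom. -/
theorem sum_prod_le_pow_card {E β : Type*} [Fintype E] [DecidableEq E] [Fintype β]
    {μ : E → β → ℝ} (hμ : ∀ e, ∑ b, μ e b = 1) (h0 : ∀ e b, 0 ≤ μ e b)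
    (A : Finset (E → β)) (T : Finset E) {a : ℝ}
    (hT : ∀ e ∈ T, ∀ b, μ e b ≤ a)
    (hA : ∀ ω ∈ A, ∀ ω' ∈ A, (∀ e ∉ T, ω e = ω' e) → ω = ω') :
    ∑ ω ∈ A, ∏ e, μ e (ω e) ≤ a ^ T.card := by
  classical
  have ha : 0 ≤ a ^ T.card := by
    rcases T.eq_empty_or_nonempty with rfl | ⟨e, he⟩
    · simp
    · rcases isEmpty_or_nonempty β with hβ | ⟨⟨b⟩⟩
      · simpa using hμ e
      · exact pow_nonneg ((h0 e b).trans (hT e he b)) _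
  -- By `hA`, restriction off `T` is injective on `A`, so only a factor `a` per point of `T` is paid
  -- and the rest is at most a total mass.
  let r : (E → β) → ({e // e ∉ T} → β) := fun ω e => ω e
  calc ∑ ω ∈ A, ∏ e, μ e (ω e)
      ≤ ∑ ω ∈ A, a ^ T.card * ∏ e : {e // e ∉ T}, μ e.1 (r ω e) := by
        refine Finset.sum_le_sum fun ω _ => ?_
        rw [← Fintype.prod_subtype_mul_prod_subtype (fun e => e ∈ T)]
        refine mul_le_mul_of_nonneg_right ?_ (Finset.prod_nonneg fun e _ => h0 _ _)
        have h : ∀ e : {e // e ∈ T}, μ e.1 (ω e.1) ≤ a := fun e => hT e.1 e.2 _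
        refine (Finset.prod_le_prod (fun e _ => h0 _ _) fun e _ => h e).trans ?_
        simp
    _ = a ^ T.card * ∑ η ∈ A.image r, ∏ e : {e // e ∉ T}, μ e.1 (η e) := by
        rw [← Finset.mul_sum, Finset.sum_image]
        intro ω hω ω' hω' h
        exact hA ω hω ω' hω' fun e he => congrFun h ⟨e, he⟩
    _ ≤ a ^ T.card * ∑ η : {e // e ∉ T} → β, ∏ e : {e // e ∉ T}, μ e.1 (η e) := by
        refine mul_le_mul_of_nonneg_left ?_ ha
        exact Finset.sum_le_sum_of_subset_of_nonneg (Finset.subset_univ _)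
          fun η _ _ => Finset.prod_nonneg fun e _ => h0 _ _
    _ = a ^ T.card := by
        rw [sum_prod_apply fun (e : {e // e ∉ T}) b => μ e.1 b]
        simp [hμ]

/-! ### Permutations and the points they move -/

/-- Among points moved by a permutation, a third form a set disjoint from its image. -/
theorem exists_disjoint_image {E : Type*} [DecidableEq E] (σ : Equiv.Perm E) (X : Finset E)
    (hX : ∀ e ∈ X, σ e ≠ e) :
    ∃ T ⊆ X, (∀ e ∈ T, σ e ∉ T) ∧ X.card ≤ 3 * T.card := by
  obtain ⟨T, hT⟩ := (X.powerset.filter fun T => ∀ e ∈ T, σ e ∉ T).exists_maximal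
    ⟨∅, by simp⟩
  have hT1 := hT.1
  simp only [Finset.mem_filter, Finset.mem_powerset] at hT1
  refine ⟨T, hT1.1, hT1.2, ?_⟩
  -- A point of `X` outside `T`, `σ T` and `σ⁻¹ T` could be added to `T`, against maximality.
  have hsub : X ⊆ T ∪ (T.image σ ∪ T.image σ.symm) := by
    intro e he
    by_contra hcon
    simp only [Finset.mem_union, Finset.mem_image, not_or, not_exists, not_and] at hcon
    obtain ⟨h1, h2, h3⟩ := hcon
    have hσ : σ e ∉ T := fun h => h3 _ h (by simp)
    have hins : insert e T ∈ X.powerset.filter fun T => ∀ e ∈ T, σ e ∉ T := by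
      simp only [Finset.mem_filter, Finset.mem_powerset]
      refine ⟨Finset.insert_subset he hT1.1, ?_⟩
      intro x hx
      rw [Finset.mem_insert] at hx ⊢
      rcases hx with rfl | hx
      · exact fun h => h.elim (hX x he) hσ
      · exact fun h => h.elim (h2 x hx) (hT1.2 x hx)
    exact h1 (hT.2 hins (Finset.subset_insert e T) (Finset.mem_insert_self e T))
  have h1 := Finset.card_le_card hsub
  have h2 := Finset.card_union_le T (T.image σ ∪ T.image σ.symm)
  have h3 := Finset.card_union_le (T.image σ) (T.image σ.symm)
  have h4 := Finset.card_image_le (s := T) (f := σ)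
  have h5 := Finset.card_image_le (s := T) (f := σ.symm)
  omega

/-- The generating function of the number of points moved by a permutation. -/
theorem sum_pow_card_support_le {V : Type*} [Fintype V] [DecidableEq V] {x : ℝ} (hx : 0 ≤ x) :
    ∑ π : Equiv.Perm V, x ^ π.support.card ≤ (1 + Fintype.card V * x) ^ Fintype.card V := by
  calc ∑ π : Equiv.Perm V, x ^ π.support.card
      = ∑ π : Equiv.Perm V, ∏ v, (if π v = v then 1 else x) := by
        refine Finset.sum_congr rfl fun π _ => ?_
        rw [Finset.prod_ite]
        simp [Equiv.Perm.support]
    _ = ∑ f ∈ (Finset.univ : Finset (Equiv.Perm V)).image (fun π v => π v),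
          ∏ v, (if f v = v then 1 else x) := by
        rw [Finset.sum_image]
        intro π _ π' _ h
        exact Equiv.ext (congrFun h)
    -- Dropping bijectivity makes the sum factorize over the vertices.
    _ ≤ ∑ f : V → V, ∏ v, (if f v = v then 1 else x) := by
        refine Finset.sum_le_sum_of_subset_of_nonneg (Finset.subset_univ _) fun f _ _ => ?_
        exact Finset.prod_nonneg fun v _ => by split_ifs <;> simp [hx]
    _ = ∏ v : V, ∑ u : V, (if u = v then 1 else x) :=
        sum_prod_apply fun v u : V => if u = v then 1 else x
    _ ≤ ∏ _v : V, (1 + Fintype.card V * x) := by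
        refine Finset.prod_le_prod
          (fun v _ => Finset.sum_nonneg fun u _ => by split_ifs <;> simp [hx]) fun v _ => ?_
        calc ∑ u : V, (if u = v then 1 else x) ≤ ∑ u : V, ((if u = v then 1 else 0) + x) :=
              Finset.sum_le_sum fun u _ => by split_ifs <;> simp [hx]
          _ = 1 + Fintype.card V * x := by simp [Finset.sum_add_distrib]
    _ = _ := by simp

/-! ### Labelled graphs as independent pairs, and permutations acting on them -/

section GraphWeight

open scoped Classical

/-- A labelled graph, viewed as the configuration of its present and absent pairs. -/
noncomputable def edgeConfigEquiv (V : Type*) :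
    SimpleGraph V ≃ ({e : Sym2 V // ¬ e.IsDiag} → Bool) where
  toFun G e := decide (e.1 ∈ G.edgeSet)
  invFun ω := SimpleGraph.fromEdgeSet {e | ∃ h : ¬ e.IsDiag, ω ⟨e, h⟩ = true}
  left_inv G := by
    ext u v
    simp only [SimpleGraph.fromEdgeSet_adj, Set.mem_ofPred_eq, decide_eq_true_eq,
      SimpleGraph.mem_edgeSet, Sym2.mk_isDiag_iff]
    exact ⟨fun h => h.1.2, fun h => ⟨⟨h.ne, h⟩, h.ne⟩⟩
  right_inv ω := by
    funext ⟨e, he⟩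
    rw [Bool.eq_iff_iff]
    simp [he]

/-- The marginal distribution of a single pair in the stochastic block model. -/
noncomputable def pairWeight {V ι : Type*} (c : V → ι) (p q : unitInterval)
    (e : {e : Sym2 V // ¬ e.IsDiag}) (b : Bool) : ℝ :=
  if b then (blockEdgeProb c p q e : ℝ) else 1 - blockEdgeProb c p q e

variable {V ι : Type*} (c : V → ι) (p q : unitInterval)

theorem pairWeight_nonneg (e : {e : Sym2 V // ¬ e.IsDiag}) (b : Bool) :
    0 ≤ pairWeight c p q e b := by
  unfold pairWeight
  split_ifs
  · exact (blockEdgeProb c p q e).2.1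
  · exact sub_nonneg.2 (blockEdgeProb c p q e).2.2

theorem pairWeight_le_one (e : {e : Sym2 V // ¬ e.IsDiag}) (b : Bool) :
    pairWeight c p q e b ≤ 1 := by
  unfold pairWeight
  split_ifs
  · exact (blockEdgeProb c p q e).2.2
  · exact sub_le_self _ (blockEdgeProb c p q e).2.1

theorem sum_pairWeight (e : {e : Sym2 V // ¬ e.IsDiag}) : ∑ b, pairWeight c p q e b = 1 := by
  simp [pairWeight]

/-- The graph `G` is sent to `G'` by the part-preserving permutation `π`. -/
def MapsGraph (π : Equiv.Perm V) (G G' : SimpleGraph V) : Prop :=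
  (∀ v, c (π v) = c v) ∧ ∀ u v, G'.Adj (π u) (π v) ↔ G.Adj u v

variable {c}

theorem partitionIsomorphic_iff {G G' : SimpleGraph V} :
    PartitionIsomorphic c G G' ↔ ∃ π, MapsGraph c π G G' :=
  ⟨fun ⟨φ, h⟩ => ⟨φ.toEquiv, h, fun _ _ => φ.map_rel_iff⟩,
    fun ⟨π, h, h'⟩ => ⟨⟨π, h' _ _⟩, h⟩⟩

theorem blockEdgeProb_map {π : Equiv.Perm V} (hπ : ∀ v, c (π v) = c v) (e : Sym2 V) :
    blockEdgeProb c p q (e.map π) = blockEdgeProb c p q e := by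
  induction e with
  | _ u v => rw [Sym2.map_mk, blockEdgeProb_mk, blockEdgeProb_mk, hπ, hπ]

/-- The permutation of the unordered pairs induced by a permutation. -/
def permSym2 {V : Type*} (π : Equiv.Perm V) : Equiv.Perm (Sym2 V) where
  toFun := Sym2.map π
  invFun := Sym2.map π.symm
  left_inv e := by simp [Sym2.map_map]
  right_inv e := by simp [Sym2.map_map]

theorem MapsGraph.mem_edgeSet {π : Equiv.Perm V} {G G' : SimpleGraph V} (h : MapsGraph c π G G')
    (e : Sym2 V) : permSym2 π e ∈ G'.edgeSet ↔ e ∈ G.edgeSet := by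
  induction e with
  | _ u v => exact h.2 u v

theorem MapsGraph.unique {π : Equiv.Perm V} {G G₁ G₂ : SimpleGraph V}
    (h₁ : MapsGraph c π G G₁) (h₂ : MapsGraph c π G G₂) : G₁ = G₂ := by
  ext u v
  have h₁ := h₁.2 (π.symm u) (π.symm v)
  have h₂ := h₂.2 (π.symm u) (π.symm v)
  simp only [Equiv.apply_symm_apply] at h₁ h₂
  rw [h₁, h₂]

theorem exists_mapsGraph {π : Equiv.Perm V} (hπ : ∀ v, c (π v) = c v) (G : SimpleGraph V) :
    ∃ G', MapsGraph c π G G' :=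
  ⟨G.comap π.symm, hπ, fun u v => by simp⟩

theorem MapsGraph.trans {π ρ : Equiv.Perm V} {G G' G'' : SimpleGraph V}
    (h : MapsGraph c π G G') (h' : MapsGraph c ρ G' G'') : MapsGraph c (ρ * π) G G'' :=
  ⟨fun v => (h'.1 _).trans (h.1 v), fun u v => (h'.2 _ _).trans (h.2 u v)⟩

theorem MapsGraph.symm {π : Equiv.Perm V} {G G' : SimpleGraph V}
    (h : MapsGraph c π G G') : MapsGraph c π⁻¹ G' G := by
  refine ⟨fun v => ?_, fun u v => ?_⟩
  · rw [← h.1 (π⁻¹ v)]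
    simp
  · rw [← h.2]
    simp

variable (c)

variable [Fintype V]

/-- The probability of a labelled graph in the stochastic block model, as a real number. -/
noncomputable def graphWeight (G : SimpleGraph V) : ℝ :=
  (stochasticBlockModel c p q G).toReal

theorem graphWeight_eq_prod (G : SimpleGraph V) :
    graphWeight c p q G = ∏ e, pairWeight c p q e (edgeConfigEquiv V G e) := by
  rw [graphWeight, stochasticBlockModel, PMF.ofFintype_apply, blockMass, ENNReal.toReal_prod,
    ← Finset.prod_subtype_eq_prod_filter]
  simp only [Finset.subtype_univ]
  refine Finset.prod_congr rfl fun e _ => ?_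
  have h0 := (blockEdgeProb c p q e).2.1
  have h1 := sub_nonneg.2 (blockEdgeProb c p q e).2.2
  by_cases h : e.1 ∈ G.edgeSet
  · simp [pairWeight, edgeConfigEquiv, h, ENNReal.toReal_ofReal h0]
  · simp [pairWeight, edgeConfigEquiv, h, ENNReal.toReal_ofReal h1]

theorem graphWeight_nonneg (G : SimpleGraph V) : 0 ≤ graphWeight c p q G :=
  ENNReal.toReal_nonneg

theorem sum_graphWeight : ∑ G, graphWeight c p q G = 1 := by
  have h := (stochasticBlockModel c p q).tsum_coe
  rw [tsum_fintype] at h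
  simp only [graphWeight]
  rw [← ENNReal.toReal_sum fun G _ => PMF.apply_ne_top _ G, h, ENNReal.toReal_one]

/-- Transfers expectations over graphs to the product space, where the moment formulas above apply.
-/
theorem sum_graphWeight_mul (F : SimpleGraph V → ℝ)
    (Φ : ({e : Sym2 V // ¬ e.IsDiag} → Bool) → ℝ) (h : ∀ G, F G = Φ (edgeConfigEquiv V G)) :
    ∑ G, graphWeight c p q G * F G
      = ∑ ω : {e : Sym2 V // ¬ e.IsDiag} → Bool, (∏ e, pairWeight c p q e (ω e)) * Φ ω := by
  rw [← (edgeConfigEquiv V).sum_comp]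
  exact Finset.sum_congr rfl fun G _ => by rw [graphWeight_eq_prod, h]

variable {c}

theorem MapsGraph.graphWeight_eq {π : Equiv.Perm V} {G G' : SimpleGraph V}
    (h : MapsGraph c π G G') : graphWeight c p q G' = graphWeight c p q G := by
  unfold graphWeight
  congr 1
  rw [stochasticBlockModel, PMF.ofFintype_apply, PMF.ofFintype_apply, blockMass, blockMass]
  symm
  refine Finset.prod_equiv (permSym2 π) (fun e => ?_) fun e _ => ?_
  · simp [permSym2, Sym2.isDiag_map π.injective]
  · simp only [h.mem_edgeSet]
    simp only [permSym2, Equiv.coe_fn_mk, blockEdgeProb_map p q h.1]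

/-! ### Automorphisms and orbit counting -/

variable (c)

/-- The part-preserving automorphisms of a graph. -/
noncomputable def partAut (G : SimpleGraph V) : Finset (Equiv.Perm V) :=
  Finset.univ.filter fun π => MapsGraph c π G G

/-- The permutations that preserve the parts. -/
noncomputable def partPerms : Finset (Equiv.Perm V) :=
  Finset.univ.filter fun π => ∀ v, c (π v) = c v

variable {c}

/-- The isomorphisms from `G` to `G'` form the coset of the automorphism group of `G` through `ρ`.
-/
theorem MapsGraph.card_filter_eq {ρ : Equiv.Perm V} {G G' : SimpleGraph V}
    (h : MapsGraph c ρ G G') :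
    (Finset.univ.filter fun π => MapsGraph c π G G').card = (partAut c G).card := by
  refine Finset.card_nbij' (fun π => ρ⁻¹ * π) (fun π => ρ * π) ?_ ?_ ?_ ?_
  · intro π hπ
    simp only [partAut, Finset.coe_filter, Finset.mem_univ, true_and, Set.mem_ofPred_eq] at hπ ⊢
    exact hπ.trans h.symm
  · intro π hπ
    simp only [partAut, Finset.coe_filter, Finset.mem_univ, true_and, Set.mem_ofPred_eq] at hπ ⊢
    exact hπ.trans h
  · intro π _
    simp
  · intro π _
    simp

theorem one_mem_partAut (G : SimpleGraph V) : 1 ∈ partAut c G :=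
  Finset.mem_filter.2 ⟨Finset.mem_univ _, fun _ => rfl, fun _ _ => Iff.rfl⟩

theorem card_partAut_pos (G : SimpleGraph V) : 0 < (partAut c G).card :=
  Finset.card_pos.2 ⟨1, one_mem_partAut G⟩

theorem card_partAut_le (G : SimpleGraph V) : (partAut c G).card ≤ (partPerms c).card :=
  Finset.card_le_card fun π hπ => by
    simp only [partAut, partPerms, Finset.mem_filter, Finset.mem_univ, true_and] at hπ ⊢
    exact hπ.1

theorem card_partPerms_pos : 0 < (partPerms c).card :=
  (card_partAut_pos ⊥).trans_le (card_partAut_le ⊥)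

theorem structureLaw_toReal (S : PartitionedStructure c) :
    (structureLaw c p q S).toReal
      = ∑ G, if S = Quotient.mk (partitionSetoid c) G then graphWeight c p q G else 0 := by
  rw [structureLaw, PMF.map_apply, tsum_fintype, ENNReal.toReal_sum]
  · refine Finset.sum_congr rfl fun G _ => ?_
    split_ifs
    · rfl
    · rfl
  · intro G _
    split_ifs
    · exact PMF.apply_ne_top _ G
    · simp

/-- The orbit-counting identity for the probability of a partitioned structure. -/
theorem structureLaw_mk_mul_card_partAut (G : SimpleGraph V) :
    (structureLaw c p q (Quotient.mk (partitionSetoid c) G)).toReal * (partAut c G).card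
      = (partPerms c).card * graphWeight c p q G := by
  -- Double count pairs `(G', π)` with `π` sending `G` to `G'`, weighted by the probability of `G'`.
  -- Grouping by `G'` gives the left side; grouping by `π` leaves one image for each part-preserving
  -- `π`, of the same probability as `G`.
  have h1 : ∑ G', ∑ π, (if MapsGraph c π G G' then graphWeight c p q G' else 0)
      = (structureLaw c p q (Quotient.mk (partitionSetoid c) G)).toReal * (partAut c G).card := by
    rw [structureLaw_toReal, Finset.sum_mul]
    refine Finset.sum_congr rfl fun G' _ => ?_
    rw [← Finset.sum_filter, Finset.sum_const, nsmul_eq_mul]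
    split_ifs with h
    · obtain ⟨ρ, hρ⟩ := partitionIsomorphic_iff.1 (Quotient.exact h)
      rw [hρ.card_filter_eq, mul_comm]
    · rw [Finset.filter_false_of_mem]
      · simp
      · exact fun π _ hπ => h (Quotient.sound (partitionIsomorphic_iff.2 ⟨π, hπ⟩))
  rw [← h1, Finset.sum_comm, partPerms, Finset.card_filter, Nat.cast_sum, Finset.sum_mul]
  refine Finset.sum_congr rfl fun π _ => ?_
  by_cases hπ : ∀ v, c (π v) = c v
  · obtain ⟨G', hG'⟩ := exists_mapsGraph hπ G
    rw [Finset.sum_eq_single G', if_pos hG', if_pos hπ, hG'.graphWeight_eq]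
    · simp
    · exact fun G'' _ hne => if_neg fun h => hne (h.unique hG')
    · simp
  · rw [if_neg hπ, Finset.sum_eq_zero]
    · simp
    · exact fun G' _ => if_neg fun h => hπ h.1

/-- These permutations are the stabilizer of `c` under precomposition. -/
theorem card_partPerms [Fintype ι] :
    (partPerms c).card = ∏ i, (Nat.card {v // c v = i}).factorial := by
  have h := DomMulAct.stabilizer_card c
  rw [Fintype.card_subtype] at h
  rw [partPerms]
  simp only [funext_iff, Function.comp_apply, ← Nat.card_eq_fintype_card] at h
  exact h

end GraphWeight

/-! ### Entropy decomposition and concentration of the self-information -/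

section StructureEntropy

open scoped Classical

variable {V ι : Type*} [Fintype V] (c : V → ι) (p q : unitInterval)

/-- The self-information, in bits, of a labelled graph, as a sum over the pairs. -/
noncomputable def graphInfo (G : SimpleGraph V) : ℝ :=
  ∑ e, -Real.logb 2 (pairWeight c p q e (edgeConfigEquiv V G e))

theorem logb_graphWeight {G : SimpleGraph V} (hG : graphWeight c p q G ≠ 0) :
    Real.logb 2 (graphWeight c p q G) = -graphInfo c p q G := by
  rw [graphWeight_eq_prod] at hG ⊢
  rw [Real.logb_prod _ _ fun e he => Finset.prod_ne_zero_iff.1 hG e he, graphInfo,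
    Finset.sum_neg_distrib, neg_neg]

theorem neg_logb_structureLaw {G : SimpleGraph V} (hG : graphWeight c p q G ≠ 0) :
    -Real.logb 2 (structureLaw c p q (Quotient.mk (partitionSetoid c) G)).toReal
      = graphInfo c p q G - Real.logb 2 (partPerms c).card
        + Real.logb 2 (partAut c G).card := by
  have hA : ((partAut c G).card : ℝ) ≠ 0 := by exact_mod_cast (card_partAut_pos G).ne'
  have hP : ((partPerms c).card : ℝ) ≠ 0 := by exact_mod_cast card_partPerms_pos.ne'
  rw [eq_div_of_mul_eq hA (structureLaw_mk_mul_card_partAut p q G),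
    Real.logb_div (mul_ne_zero hP hG) hA, Real.logb_mul hP hG, logb_graphWeight c p q hG]
  ring

/-- Averaging over structures is averaging over labelled graphs, each evaluated at its class. -/
theorem partitionedStructuralEntropy_eq_sum :
    partitionedStructuralEntropy c p q = ∑ G, graphWeight c p q G *
      -Real.logb 2 (structureLaw c p q (Quotient.mk (partitionSetoid c) G)).toReal := by
  rw [partitionedStructuralEntropy, shannonEntropy, ← Finset.sum_neg_distrib]
  have h : ∀ S : PartitionedStructure c,
      -((structureLaw c p q S).toReal * Real.logb 2 (structureLaw c p q S).toReal)
        = ∑ G, if S = Quotient.mk (partitionSetoid c) G then graphWeight c p q G *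
          -Real.logb 2 (structureLaw c p q S).toReal else 0 := fun S => by
    conv_lhs => rw [← mul_neg, structureLaw_toReal p q S, Finset.sum_mul]
    refine Finset.sum_congr rfl fun G _ => ?_
    rw [ite_mul, zero_mul, ← structureLaw_toReal p q S]
  rw [Finset.sum_congr rfl fun S _ => h S, Finset.sum_comm]
  refine Finset.sum_congr rfl fun G _ => ?_
  rw [Finset.sum_ite_eq' Finset.univ]
  simp

omit [Fintype V] in
theorem sum_pairWeight_mul_neg_logb (e : {e : Sym2 V // ¬ e.IsDiag}) :
    ∑ b, pairWeight c p q e b * -Real.logb 2 (pairWeight c p q e b)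
      = binaryEntropyBits (blockEdgeProb c p q e) := by
  simp [pairWeight, binaryEntropyBits]
  ring

theorem sum_graphWeight_mul_graphInfo :
    ∑ G, graphWeight c p q G * graphInfo c p q G
      = ∑ e : {e : Sym2 V // ¬ e.IsDiag}, binaryEntropyBits (blockEdgeProb c p q e) := by
  rw [sum_graphWeight_mul c p q (graphInfo c p q)
    (fun ω => ∑ e, -Real.logb 2 (pairWeight c p q e (ω e))) fun G => rfl,
    sum_prod_mul_sum (sum_pairWeight c p q)
      (fun e b => -Real.logb 2 (pairWeight c p q e b))]
  exact Finset.sum_congr rfl fun e _ => sum_pairWeight_mul_neg_logb c p q e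

/-- The structural entropy is the labelled entropy, minus the logarithm of the number of
part-preserving permutations, plus the expected logarithm of the number of automorphisms. -/
theorem partitionedStructuralEntropy_eq :
    partitionedStructuralEntropy c p q
      = ∑ e : {e : Sym2 V // ¬ e.IsDiag}, binaryEntropyBits (blockEdgeProb c p q e)
        - Real.logb 2 (partPerms c).card
        + ∑ G, graphWeight c p q G * Real.logb 2 (partAut c G).card := by
  have h : ∀ G : SimpleGraph V, graphWeight c p q G *
      -Real.logb 2 (structureLaw c p q (Quotient.mk (partitionSetoid c) G)).toReal
      = graphWeight c p q G * graphInfo c p q G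
        - graphWeight c p q G * Real.logb 2 (partPerms c).card
        + graphWeight c p q G * Real.logb 2 (partAut c G).card := fun G => by
    -- Since `Real.logb 2 0 = 0`, the decomposition of the logarithm can fail at probability zero,
    -- but there every term has weight zero.
    by_cases hG : graphWeight c p q G = 0
    · simp [hG]
    · rw [neg_logb_structureLaw c p q hG]
      ring
  rw [partitionedStructuralEntropy_eq_sum, Finset.sum_congr rfl fun G _ => h G,
    Finset.sum_add_distrib, Finset.sum_sub_distrib, sum_graphWeight_mul_graphInfo,
    ← Finset.sum_mul, sum_graphWeight, one_mul]

/-- Apply |y ln y| < 1 at y = √x. The bound is uniform in `x`, so it holds however `p` and `q` vary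
with `n`. -/
theorem mul_logb_sq_le {x : ℝ} (h0 : 0 ≤ x) (h1 : x ≤ 1) :
    x * Real.logb 2 x ^ 2 ≤ 4 / Real.log 2 ^ 2 := by
  rcases h0.eq_or_lt with rfl | hx
  · simp
    positivity
  · have hs := Real.abs_log_mul_self_lt (√x) (Real.sqrt_pos.2 hx) (Real.sqrt_le_one.2 h1)
    rw [Real.log_sqrt h0] at hs
    have hs2 := (sq_lt_one_iff_abs_lt_one _).2 hs
    rw [mul_pow, Real.sq_sqrt h0] at hs2
    rw [Real.logb, div_pow, ← mul_div_assoc]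
    gcongr
    nlinarith

-- The variance is at most the second moment, to which each of the two outcomes contributes at most
-- 4/ln² 2.
omit [Fintype V] in
theorem sum_pairWeight_mul_sq_le (e : {e : Sym2 V // ¬ e.IsDiag}) :
    ∑ b, pairWeight c p q e b * (-Real.logb 2 (pairWeight c p q e b)
      - binaryEntropyBits (blockEdgeProb c p q e)) ^ 2 ≤ 8 / Real.log 2 ^ 2 := by
  have h1 := sum_pairWeight c p q e
  have h2 := sum_pairWeight_mul_neg_logb c p q e
  have h3 := mul_logb_sq_le (pairWeight_nonneg c p q e true) (pairWeight_le_one c p q e true)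
  have h4 := mul_logb_sq_le (pairWeight_nonneg c p q e false) (pairWeight_le_one c p q e false)
  have h5 : 8 / Real.log 2 ^ 2 = 4 / Real.log 2 ^ 2 + 4 / Real.log 2 ^ 2 := by ring
  simp only [Fintype.sum_bool] at h1 h2 ⊢
  rw [← h2, h5]
  generalize pairWeight c p q e true = x at *
  generalize pairWeight c p q e false = y at *
  generalize Real.logb 2 x = k at *
  generalize Real.logb 2 y = l at *
  obtain rfl : y = 1 - x := by linarith
  nlinarith [sq_nonneg (x * -k + (1 - x) * -l)]

theorem sum_graphWeight_mul_sq_le :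
    ∑ G, graphWeight c p q G * (graphInfo c p q G
      - ∑ e : {e : Sym2 V // ¬ e.IsDiag}, binaryEntropyBits (blockEdgeProb c p q e)) ^ 2
      ≤ (Fintype.card V).choose 2 * (8 / Real.log 2 ^ 2) := by
  rw [sum_graphWeight_mul c p q _ (fun ω => (∑ e, (-Real.logb 2 (pairWeight c p q e (ω e))
      - binaryEntropyBits (blockEdgeProb c p q e))) ^ 2) fun G => by
    rw [Finset.sum_sub_distrib, graphInfo],
    sum_prod_mul_sum_sq (sum_pairWeight c p q) (fun e b => -Real.logb 2 (pairWeight c p q e b)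
      - binaryEntropyBits (blockEdgeProb c p q e))]
  · refine (Finset.sum_le_sum fun e _ => sum_pairWeight_mul_sq_le c p q e).trans ?_
    rw [Finset.sum_const, nsmul_eq_mul, Finset.card_univ, Sym2.card_subtype_not_diag]
  · intro e
    simp only [mul_sub, Finset.sum_sub_distrib, sum_pairWeight_mul_neg_logb, ← Finset.sum_mul,
      sum_pairWeight, one_mul, sub_self]

/-- Chebyshev's inequality for the self-information of a labelled graph. -/
theorem sum_graphWeight_deviation_le {t : ℝ} (ht : 0 < t) :
    ∑ G, (if t ≤ |graphInfo c p q G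
      - ∑ e : {e : Sym2 V // ¬ e.IsDiag}, binaryEntropyBits (blockEdgeProb c p q e)|
      then graphWeight c p q G else 0)
      ≤ (Fintype.card V).choose 2 * (8 / Real.log 2 ^ 2) / t ^ 2 := by
  rw [le_div_iff₀ (by positivity), Finset.sum_mul]
  refine le_trans (Finset.sum_le_sum fun G _ => ?_) (sum_graphWeight_mul_sq_le c p q)
  have h0 := graphWeight_nonneg c p q G
  split_ifs with h
  · rw [← sq_abs (graphInfo c p q G - _)]
    gcongr
  · rw [zero_mul]
    positivity

theorem structureLaw_toOuterMeasure_toReal (s : Set (PartitionedStructure c)) :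
    ((structureLaw c p q).toOuterMeasure s).toReal
      = ∑ G, if Quotient.mk (partitionSetoid c) G ∈ s then graphWeight c p q G else 0 := by
  rw [structureLaw, PMF.toOuterMeasure_map_apply, PMF.toOuterMeasure_apply, tsum_fintype,
    ENNReal.toReal_sum]
  · refine Finset.sum_congr rfl fun G _ => ?_
    simp only [Set.indicator, Set.mem_preimage]
    split_ifs <;> rfl
  · intro G _
    simp only [Set.indicator]
    split_ifs
    · exact PMF.apply_ne_top _ G
    · simp

/-! ### Pairs inside the parts and the expected number of automorphisms -/

variable {c}

/-- Handshake count in the disjoint union of cliques on the parts, which is (m-1)-regular. -/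
theorem card_pairs_inside {m : ℕ} (hm : ∀ v, Nat.card {u // c u = c v} = m) :
    2 * (Finset.univ.filter fun e : {e : Sym2 V // ¬ e.IsDiag} => (e.1.map c).IsDiag).card
      = Fintype.card V * (m - 1) := by
  simp only [Nat.card_eq_fintype_card, Fintype.card_subtype] at hm
  let H : SimpleGraph V :=
    { Adj := fun u v => u ≠ v ∧ c u = c v
      symm := ⟨fun _ _ h => ⟨h.1.symm, h.2.symm⟩⟩
      loopless := ⟨fun _ h => h.1 rfl⟩ }
  have hE : (Finset.univ.filter fun e : {e : Sym2 V // ¬ e.IsDiag} => (e.1.map c).IsDiag).card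
      = H.edgeFinset.card := by
    rw [← Finset.card_map (Function.Embedding.subtype _)]
    congr 1
    ext e
    induction e with
    | _ u v => simp [H]; tauto
  rw [hE, ← H.sum_degrees_eq_twice_card_edges]
  have hd : ∀ v, H.degree v = m - 1 := fun v => by
    rw [← hm v, ← Finset.card_erase_of_mem (a := v) (by simp), ← H.card_neighborFinset_eq_degree]
    congr 1
    ext u
    simp [H, eq_comm]
  simp [hd]

theorem sum_binaryEntropyBits {m : ℕ} (hV : Fintype.card V = 2 * m)
    (hm : ∀ v, Nat.card {u // c u = c v} = m) :
    ∑ e : {e : Sym2 V // ¬ e.IsDiag}, binaryEntropyBits (blockEdgeProb c p q e)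
      = 2 * (m.choose 2 : ℝ) * binaryEntropyBits p + (m : ℝ) ^ 2 * binaryEntropyBits q := by
  have h1 := card_pairs_inside hm
  have h2 := Finset.card_filter_add_card_filter_not
    (s := (Finset.univ : Finset {e : Sym2 V // ¬ e.IsDiag})) fun e => (e.1.map c).IsDiag
  rw [Finset.card_univ, Sym2.card_subtype_not_diag, hV] at h2
  rw [hV] at h1
  have h3 : ∀ e : {e : Sym2 V // ¬ e.IsDiag}, binaryEntropyBits (blockEdgeProb c p q e)
      = if (e.1.map c).IsDiag then binaryEntropyBits p else binaryEntropyBits q := fun e => by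
    unfold blockEdgeProb
    split_ifs <;> rfl
  rw [Finset.sum_congr rfl fun e _ => h3 e, Finset.sum_ite, Finset.sum_const, Finset.sum_const,
    nsmul_eq_mul, nsmul_eq_mul]
  set a := (Finset.univ.filter fun e : {e : Sym2 V // ¬ e.IsDiag} => (e.1.map c).IsDiag).card
  set b := (Finset.univ.filter
    fun e : {e : Sym2 V // ¬ e.IsDiag} => ¬ (e.1.map c).IsDiag).card
  have h2' : (a : ℝ) + b = ((2 * m).choose 2 : ℕ) := by exact_mod_cast h2
  rw [Nat.cast_choose_two] at h2'
  have h1' : 2 * (a : ℝ) = 2 * m * (m - 1) := by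
    rcases Nat.eq_zero_or_pos m with rfl | hpos
    · simpa using h1
    · have := congrArg (Nat.cast : ℕ → ℝ) h1
      push_cast [Nat.cast_sub hpos] at this
      exact this
  rw [Nat.cast_choose_two]
  push_cast at h2'
  have ha : (a : ℝ) = m * (m - 1) := by linarith
  have hb : (b : ℝ) = m ^ 2 := by
    rw [ha] at h2'
    linarith
  rw [ha, hb]
  ring

/-- The pairs inside the parts that are moved by a permutation `π` contain a
large set which is disjoint from its image under `π`. -/
theorem exists_disjoint_pairs {m : ℕ} (hm : ∀ v, Nat.card {u // c u = c v} = m)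
    (π : Equiv.Perm V) :
    ∃ T : Finset (Sym2 V), (∀ e ∈ T, ¬ e.IsDiag ∧ (e.map c).IsDiag) ∧
      (∀ e ∈ T, permSym2 π e ∉ T) ∧ π.support.card * m ≤ 6 * T.card + 2 * π.support.card := by
  simp only [Nat.card_eq_fintype_card, Fintype.card_subtype] at hm
  -- The edges of `D` are the pairs inside a part that `π` moves.
  let D : SimpleGraph V :=
    { Adj := fun u v => u ≠ v ∧ c u = c v ∧ s(π u, π v) ≠ s(u, v)
      symm := ⟨fun u v h => ⟨h.1.symm, h.2.1.symm, by
        rw [Sym2.eq_swap, Sym2.eq_swap (a := v)]; exact h.2.2⟩⟩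
      loopless := ⟨fun _ h => h.1 rfl⟩ }
  obtain ⟨T, hTD, hT, hcard⟩ := exists_disjoint_image (permSym2 π) D.edgeFinset fun e he => by
    induction e with
    | _ u v =>
      rw [SimpleGraph.mem_edgeFinset] at he
      exact (show D.Adj u v from he).2.2
  refine ⟨T, fun e he => ?_, hT, ?_⟩
  · have he' := hTD he
    induction e with
    | _ u v =>
      rw [SimpleGraph.mem_edgeFinset] at he'
      have h : D.Adj u v := he'
      simpa using ⟨h.1, h.2.1⟩
  -- If `π` moves `v`, a pair `s(u, v)` can be fixed only by swapping its ends, so u = π v. The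
  -- factor 6 is 3 from the choice of `T` times 2 from the handshake.
  · have hdeg : ∀ v ∈ π.support, m ≤ D.degree v + 2 := fun v hv => by
      have hsub : (Finset.univ.filter fun u => c u = c v) ⊆ D.neighborFinset v ∪ {v, π v} := by
        intro u hu
        rw [Finset.mem_filter] at hu
        by_cases h1 : u = v
        · simp [h1]
        by_cases h2 : u = π v
        · simp [h2]
        have : D.Adj v u := by
          refine ⟨Ne.symm h1, hu.2.symm, fun h => ?_⟩
          rcases Sym2.eq_iff.1 h with h | h
          · exact Equiv.Perm.mem_support.1 hv h.1
          · exact h2 h.1.symm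
        simp [this]
      have h1 := (Finset.card_le_card hsub).trans (Finset.card_union_le _ _)
      rw [hm v, D.card_neighborFinset_eq_degree] at h1
      exact h1.trans (Nat.add_le_add_left Finset.card_le_two _)
    have h1 := Finset.sum_le_sum hdeg
    rw [Finset.sum_add_distrib, Finset.sum_const, Finset.sum_const, smul_eq_mul,
      smul_eq_mul] at h1
    have h2 : ∑ v ∈ π.support, D.degree v ≤ 2 * D.edgeFinset.card := by
      rw [← D.sum_degrees_eq_twice_card_edges]
      exact Finset.sum_le_sum_of_subset (Finset.subset_univ _)
    omega

/-- A given permutation moving many vertices is unlikely to be an automorphism. -/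
theorem sum_graphWeight_mapsGraph_le {m : ℕ}
    (hm : ∀ v, Nat.card {u // c u = c v} = m)
    (π : Equiv.Perm V) {s x : ℝ} (hs : 0 ≤ s) (hsp : s ≤ p)
    (hsp' : s ≤ 1 - p) (hx : Real.exp (-(s * (m - 2) / 6)) ≤ x) :
    ∑ G with MapsGraph c π G G, graphWeight c p q G ≤ x ^ π.support.card := by
  obtain ⟨T, hT, hdisj, hcard⟩ := exists_disjoint_pairs hm π
  let T' : Finset {e : Sym2 V // ¬ e.IsDiag} := T.subtype _
  have hT' : T'.card = T.card := by
    rw [Finset.card_subtype, Finset.filter_true_of_mem fun e he => (hT e he).1]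
  have h1 : ∑ G with MapsGraph c π G G, graphWeight c p q G ≤ (1 - s) ^ T'.card := by
    have h := sum_prod_le_pow_card (sum_pairWeight c p q) (pairWeight_nonneg c p q)
      ((Finset.univ.filter fun G => MapsGraph c π G G).map (edgeConfigEquiv V).toEmbedding) T'
      (a := 1 - s) ?_ ?_
    · rw [Finset.sum_map] at h
      simpa only [graphWeight_eq_prod, Equiv.coe_toEmbedding] using h
    · intro e he b
      have hd := (hT e.1 (Finset.mem_subtype.1 he)).2
      unfold pairWeight blockEdgeProb
      rw [if_pos hd]
      split_ifs <;> linarith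
    · intro ω hω ω' hω' h
      simp only [Finset.mem_map, Finset.mem_filter, Finset.mem_univ, true_and] at hω hω'
      obtain ⟨G, hG, rfl⟩ := hω
      obtain ⟨G', hG', rfl⟩ := hω'
      have hoff : ∀ e : Sym2 V, e ∉ T → (e ∈ G.edgeSet ↔ e ∈ G'.edgeSet) := fun e he => by
        by_cases hd : e.IsDiag
        · exact iff_of_false (fun h => G.not_isDiag_of_mem_edgeSet h hd)
            (fun h => G'.not_isDiag_of_mem_edgeSet h hd)
        · simpa [edgeConfigEquiv] using h ⟨e, hd⟩ (by simpa [T'] using he)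
      have hon : ∀ e : Sym2 V, e ∈ G.edgeSet ↔ e ∈ G'.edgeSet := fun e => by
        by_cases he : e ∈ T
        -- An automorphism copies the status of `e` from its image, which lies off `T`.
        · rw [← hG.mem_edgeSet, ← hG'.mem_edgeSet]
          exact hoff _ (hdisj e he)
        · exact hoff e he
      rw [SimpleGraph.edgeSet_inj.1 (Set.ext hon)]
  refine h1.trans ?_
  rw [hT']
  have h2 : (π.support.card : ℝ) * m ≤ 6 * T.card + 2 * π.support.card := by
    exact_mod_cast hcard
  calc (1 - s) ^ T.card ≤ Real.exp (-s) ^ T.card := by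
        gcongr
        · linarith [p.2.2]
        · exact Real.one_sub_le_exp_neg s
    _ = Real.exp (-(s * T.card)) := by
        rw [← Real.exp_nat_mul]
        ring_nf
    _ ≤ Real.exp (π.support.card * -(s * (m - 2) / 6)) := by
        gcongr
        nlinarith
    _ = Real.exp (-(s * (m - 2) / 6)) ^ π.support.card := by
        rw [← Real.exp_nat_mul]
    _ ≤ x ^ π.support.card := by
        gcongr

/-- Few automorphisms are expected. -/
theorem sum_graphWeight_mul_card_partAut_le {m : ℕ}
    (hm : ∀ v, Nat.card {u // c u = c v} = m)
    {s x : ℝ} (hs : 0 ≤ s) (hsp : s ≤ p)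
    (hsp' : s ≤ 1 - p) (hx : Real.exp (-(s * (m - 2) / 6)) ≤ x) :
    ∑ G, graphWeight c p q G * (partAut c G).card
      ≤ (1 + Fintype.card V * x) ^ Fintype.card V := by
  have hx0 : 0 ≤ x := (Real.exp_pos _).le.trans hx
  refine le_trans ?_ (sum_pow_card_support_le hx0)
  have h : ∀ G : SimpleGraph V, graphWeight c p q G * (partAut c G).card
      = ∑ π, if MapsGraph c π G G then graphWeight c p q G else 0 := fun G => by
    rw [← Finset.sum_filter, Finset.sum_const, nsmul_eq_mul, mul_comm, partAut]
  rw [Finset.sum_congr rfl fun G _ => h G, Finset.sum_comm]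
  refine Finset.sum_le_sum fun π _ => ?_
  rw [← Finset.sum_filter]
  exact sum_graphWeight_mapsGraph_le p q hm π hs hsp hsp' hx

end StructureEntropy

/-! ### Two equal parts: explicit bounds -/

section Balanced

open scoped Classical

variable {V : Type*} [Fintype V] {c : V → Fin 2} {n m : ℕ} (p q : unitInterval)

theorem IsBalancedBipartition.fintype_card (h : IsBalancedBipartition n c) :
    Fintype.card V = n := by
  rw [← Nat.card_eq_fintype_card, h.1]

omit [Fintype V] in
theorem IsBalancedBipartition.card_part (h : IsBalancedBipartition (2 * m) c) (i : Fin 2) :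
    Nat.card {v // c v = i} = m := by
  have := h.2 i
  omega

theorem IsBalancedBipartition.logb_card_partPerms (h : IsBalancedBipartition (2 * m) c) :
    Real.logb 2 (partPerms c).card = 2 * Real.logb 2 m.factorial := by
  rw [card_partPerms]
  simp only [h.card_part, Finset.prod_const, Finset.card_univ, Fintype.card_fin]
  rw [Nat.cast_pow, Real.logb_pow, Nat.cast_ofNat]

theorem IsBalancedBipartition.sum_binaryEntropyBits (h : IsBalancedBipartition (2 * m) c) :
    ∑ e : {e : Sym2 V // ¬ e.IsDiag}, binaryEntropyBits (blockEdgeProb c p q e)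
      = 2 * (m.choose 2 : ℝ) * binaryEntropyBits p + (m : ℝ) ^ 2 * binaryEntropyBits q :=
  _root_.sum_binaryEntropyBits p q h.fintype_card fun v => h.card_part (c v)

/-- The expected logarithm of the number of automorphisms is small. -/
theorem IsBalancedBipartition.sum_graphWeight_mul_logb_card_partAut_le
    (h : IsBalancedBipartition (2 * m) c) (hm : 4 ≤ m) {s : ℝ}
    (hs : 72 * (Real.log (2 * m : ℕ) / (2 * m : ℕ)) = s) (hsp : s ≤ p) (hsp' : s ≤ 1 - p) :
    ∑ G, graphWeight c p q G * Real.logb 2 (partAut c G).card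
      ≤ 2 / (2 * m : ℕ) / Real.log 2 := by
  set n := 2 * m with hn
  have hnm : (n : ℝ) = 2 * m := by simp [hn]
  have hm4 : (4 : ℝ) ≤ m := by exact_mod_cast hm
  have hn0 : (0 : ℝ) < n := by linarith
  have hlog : 0 ≤ Real.log n := Real.log_nonneg (by linarith)
  have hs0 : 0 ≤ s := by rw [← hs]; positivity
  -- The constant 72 makes the exponent 12 ln n · (m-2)/n, which is at least 3 ln n because m ≥ 4.
  have hx : Real.exp (-(s * (m - 2) / 6)) ≤ ((n : ℝ) ^ 3)⁻¹ := by
    rw [← Real.exp_log (pow_pos hn0 3), ← Real.exp_neg, Real.log_pow]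
    refine Real.exp_le_exp.2 (neg_le_neg ?_)
    have h1 : (1 : ℝ) / 4 ≤ (m - 2) / n := by
      rw [div_le_div_iff₀ (by norm_num) hn0]
      linarith
    calc ((3 : ℕ) : ℝ) * Real.log n = 12 * Real.log n * (1 / 4) := by push_cast; ring
      _ ≤ 12 * Real.log n * ((m - 2) / n) := by gcongr
      _ = s * (m - 2) / 6 := by rw [← hs]; ring
  have hA : ∑ G, graphWeight c p q G * (partAut c G).card ≤ 1 + 2 / n := by
    refine (sum_graphWeight_mul_card_partAut_le p q (fun v => h.card_part (c v)) hs0 hsp hsp' hx).trans ?_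
    rw [h.fintype_card]
    calc (1 + (n : ℝ) * ((n : ℝ) ^ 3)⁻¹) ^ n
        ≤ Real.exp ((n : ℝ) * ((n : ℝ) ^ 3)⁻¹) ^ n := by
          gcongr
          rw [add_comm]
          exact Real.add_one_le_exp _
      _ = Real.exp (1 / n) := by
          rw [← Real.exp_nat_mul]
          congr 1
          field_simp
      _ ≤ 1 + 2 / n := by
          have h1 : |(1 : ℝ) / n| ≤ 1 := by
            rw [abs_of_nonneg (by positivity), div_le_one hn0]
            linarith
          have h2 := Real.abs_exp_sub_one_le h1
          rw [abs_of_nonneg (a := 1 / (n : ℝ)) (by positivity)] at h2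
          have h3 := (le_abs_self _).trans h2
          have h4 : 2 * (1 / (n : ℝ)) = 2 / n := by ring
          linarith
  -- Use ln k ≤ k - 1: the identity automorphism cancels the 1, leaving only the excess 2/n.
  calc ∑ G, graphWeight c p q G * Real.logb 2 (partAut c G).card
      ≤ ∑ G, graphWeight c p q G * (((partAut c G).card - 1) / Real.log 2) := by
        refine Finset.sum_le_sum fun G _ => ?_
        refine mul_le_mul_of_nonneg_left ?_ (graphWeight_nonneg c p q G)
        rw [Real.logb]
        have hl := Real.log_pos one_lt_two
        gcongr
        exact Real.log_le_sub_one_of_pos (by exact_mod_cast card_partAut_pos G)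
    _ = (∑ G, graphWeight c p q G * (partAut c G).card - 1) / Real.log 2 := by
        rw [← sum_graphWeight c p q, ← Finset.sum_sub_distrib, Finset.sum_div]
        simp only [sum_graphWeight]
        exact Finset.sum_congr rfl fun G _ => by ring
    _ ≤ 2 / n / Real.log 2 := by
        have hl := Real.log_pos one_lt_two
        gcongr
        linarith

/-- The asymptotic equipartition property for partitioned structures. -/
theorem IsBalancedBipartition.typical (h : IsBalancedBipartition (2 * m) c) (hm : 1 ≤ m)
    {ε : ℝ} (hε : 0 < ε)
    (h1 : 2 * Real.logb 2 m.factorial < ε * ((2 * m).choose 2 : ℕ))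
    (h2 : 8 / Real.log 2 ^ 2 < 16 * ε ^ 3 * ((2 * m).choose 2 : ℕ)) :
    1 - 4 * ε < ((structureLaw c p q).toOuterMeasure
      {S | |-(1 / ((2 * m).choose 2 : ℝ)) * Real.logb 2 (structureLaw c p q S).toReal
        - (((2 * m : ℕ) : ℝ) - 2) / (2 * (2 * m : ℕ) - 2) * binaryEntropyBits p
        - ((2 * m : ℕ) : ℝ) / (2 * (2 * m : ℕ) - 2) * binaryEntropyBits q
        + 2 * Real.logb 2 (m.factorial : ℝ) / ((2 * m).choose 2 : ℝ)| < 3 * ε}).toReal := by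
  rw [structureLaw_toOuterMeasure_toReal]
  set s := {S : PartitionedStructure c |
    |-(1 / ((2 * m).choose 2 : ℝ)) * Real.logb 2 (structureLaw c p q S).toReal
        - (((2 * m : ℕ) : ℝ) - 2) / (2 * (2 * m : ℕ) - 2) * binaryEntropyBits p
        - ((2 * m : ℕ) : ℝ) / (2 * (2 * m : ℕ) - 2) * binaryEntropyBits q
        + 2 * Real.logb 2 (m.factorial : ℝ) / ((2 * m).choose 2 : ℝ)| < 3 * ε} with hs
  have hm1 : (1 : ℝ) ≤ m := by exact_mod_cast hm
  have hN : (((2 * m).choose 2 : ℕ) : ℝ) = m * (2 * m - 1) := by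
    rw [Nat.cast_choose_two]
    push_cast
    ring
  set N : ℝ := (((2 * m).choose 2 : ℕ) : ℝ) with hNdef
  have hN0 : 0 < N := by
    rw [hN]
    nlinarith
  set H := ∑ e : {e : Sym2 V // ¬ e.IsDiag}, binaryEntropyBits (blockEdgeProb c p q e) with hH
  have hHN : H / N = (((2 * m : ℕ) : ℝ) - 2) / (2 * (2 * m : ℕ) - 2) * binaryEntropyBits p
      + ((2 * m : ℕ) : ℝ) / (2 * (2 * m : ℕ) - 2) * binaryEntropyBits q := by
    rw [hH, h.sum_binaryEntropyBits, hN, Nat.cast_choose_two]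
    push_cast
    have h3 : (2 * m - 1 : ℝ) ≠ 0 := by linarith
    have h4 : (2 * (2 * m) - 2 : ℝ) = 2 * (2 * m - 1) := by ring
    rw [h4]
    field_simp
  have hbad := sum_graphWeight_deviation_le c p q (t := 2 * ε * N) (by positivity)
  -- Each graph of positive probability is either typical or has self-information off by at least
  -- 2εN. The third ε is the room for log |Aut G|.
  have hgood : ∀ G : SimpleGraph V, graphWeight c p q G
      ≤ (if Quotient.mk (partitionSetoid c) G ∈ s then graphWeight c p q G else 0)
        + (if 2 * ε * N ≤ |graphInfo c p q G - H| then graphWeight c p q G else 0) := fun G => by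
    have h0 := graphWeight_nonneg c p q G
    by_cases hG : graphWeight c p q G = 0
    · simp [hG]
    by_cases hd : 2 * ε * N ≤ |graphInfo c p q G - H|
    · rw [if_pos hd]
      split_ifs <;> linarith
    · rw [if_pos, if_neg hd, add_zero]
      push Not at hd
      have hlog := neg_logb_structureLaw c p q hG
      rw [h.logb_card_partPerms] at hlog
      have hA0 : 0 ≤ Real.logb 2 (partAut c G).card :=
        Real.logb_nonneg one_lt_two (by exact_mod_cast card_partAut_pos G)
      have hA1 : Real.logb 2 (partAut c G).card < ε * N := by
        refine lt_of_le_of_lt ?_ h1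
        rw [← h.logb_card_partPerms]
        exact Real.logb_le_logb_of_le one_lt_two (by exact_mod_cast card_partAut_pos G)
          (by exact_mod_cast card_partAut_le G)
      rw [hs, Set.mem_ofPred_eq]
      have heq : -(1 / N) * Real.logb 2
            (structureLaw c p q (Quotient.mk (partitionSetoid c) G)).toReal
          - (((2 * m : ℕ) : ℝ) - 2) / (2 * (2 * m : ℕ) - 2) * binaryEntropyBits p
          - ((2 * m : ℕ) : ℝ) / (2 * (2 * m : ℕ) - 2) * binaryEntropyBits q
          + 2 * Real.logb 2 (m.factorial : ℝ) / N
          = (graphInfo c p q G - H + Real.logb 2 (partAut c G).card) / N := by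
        rw [sub_sub, ← hHN, neg_mul, ← mul_neg, hlog]
        ring
      rw [heq, abs_div, abs_of_pos hN0, div_lt_iff₀ hN0]
      refine (abs_add_le _ _).trans_lt ?_
      rw [abs_of_nonneg hA0]
      linarith
  have hsum := Finset.sum_le_sum fun G (_ : G ∈ Finset.univ) => hgood G
  rw [Finset.sum_add_distrib, sum_graphWeight] at hsum
  -- Chebyshev at distance 2εN gives 2/(ε²N ln² 2), which `h2` makes less than 4ε.
  have hlt : (Fintype.card V).choose 2 * (8 / Real.log 2 ^ 2) / (2 * ε * N) ^ 2 < 4 * ε := by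
    rw [h.fintype_card, ← hNdef, div_lt_iff₀ (by positivity)]
    calc N * (8 / Real.log 2 ^ 2) < N * (16 * ε ^ 3 * N) := by gcongr
      _ = 4 * ε * (2 * ε * N) ^ 2 := by ring
  linarith

end Balanced

/-! ### Asymptotics and the theorem -/

theorem eventually_of_isLittleO_log_div {r : ℕ → ℝ} (hr0 : ∀ n, 0 ≤ r n)
    (hr : (fun n : ℕ => Real.log n / n) =o[atTop ⊓ 𝓟 {n : ℕ | Even n}] r) {D : ℝ} (hD : 0 < D) :
    ∃ N : ℕ, ∀ n, N ≤ n → Even n → D * (Real.log n / n) ≤ r n := by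
  have h := hr.bound (inv_pos.2 hD)
  rw [eventually_inf_principal, eventually_atTop] at h
  obtain ⟨N, hN⟩ := h
  refine ⟨N, fun n hn he => ?_⟩
  have h1 := hN n hn he
  rw [Real.norm_of_nonneg (hr0 n), inv_mul_eq_div, le_div_iff₀ hD, mul_comm] at h1
  exact (mul_le_mul_of_nonneg_left (Real.le_norm_self _) hD.le).trans h1

/-- By m! ≤ m^m, the left side is of order at most m log m, while the right side is of order m². -/
theorem exists_two_mul_logb_factorial_lt {ε : ℝ} (hε : 0 < ε) :
    ∃ N : ℕ, ∀ m : ℕ, N ≤ 2 * m →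
      2 * Real.logb 2 m.factorial < ε * ((2 * m).choose 2 : ℕ) := by
  have hl := Real.log_pos one_lt_two
  have h := (Real.isLittleO_log_id_atTop.comp_tendsto tendsto_natCast_atTop_atTop).bound
    (show 0 < ε * Real.log 2 / 4 by positivity)
  rw [eventually_atTop] at h
  obtain ⟨N, hN⟩ := h
  refine ⟨2 * N + 2, fun m hm => ?_⟩
  have hm1 : (1 : ℝ) ≤ m := by exact_mod_cast (by omega : 1 ≤ m)
  have h1 := (Real.le_norm_self _).trans (hN m (by omega))
  simp only [Function.comp_apply, id_eq, Real.norm_natCast] at h1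
  have h2 : Real.log m.factorial ≤ m * Real.log m := by
    rw [← Real.log_pow]
    exact Real.log_le_log (by positivity) (by exact_mod_cast Nat.factorial_le_pow m)
  have h3 : (((2 * m).choose 2 : ℕ) : ℝ) = m * (2 * m - 1) := by
    rw [Nat.cast_choose_two]
    push_cast
    ring
  rw [h3, Real.logb, ← mul_div_assoc, div_lt_iff₀ hl]
  calc 2 * Real.log m.factorial ≤ 2 * (m * (ε * Real.log 2 / 4 * m)) := by
        have := mul_le_mul_of_nonneg_left h1 (zero_le_one.trans hm1)
        linarith
    _ = ε * Real.log 2 * (m * (m / 2)) := by ring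
    _ < ε * Real.log 2 * (m * (2 * m - 1)) := by
        gcongr
        linarith
    _ = ε * (m * (2 * m - 1)) * Real.log 2 := by ring

theorem mainTheorem1 (p q : ℕ → unitInterval)
    (hp : (fun n : ℕ => Real.log n / n) =o[atTop ⊓ 𝓟 {n : ℕ | Even n}] fun n => (p n : ℝ))
    (hq : (fun n : ℕ => Real.log n / n) =o[atTop ⊓ 𝓟 {n : ℕ | Even n}] fun n => (q n : ℝ))
    (hp' : (fun n : ℕ => Real.log n / n) =o[atTop ⊓ 𝓟 {n : ℕ | Even n}]
      fun n => 1 - (p n : ℝ)) :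
    (∃ α : ℝ, 0 < α ∧ ∃ C : ℝ, ∃ N : ℕ, ∀ n : ℕ, N ≤ n → Even n →
      ∀ (V : Type*) [Fintype V] (c : V → Fin 2), IsBalancedBipartition n c →
        |partitionedStructuralEntropy c (p n) (q n)
            - (2 * ((n / 2).choose 2 : ℝ) * binaryEntropyBits (p n)
              + (n : ℝ) ^ 2 / 4 * binaryEntropyBits (q n)
              - 2 * Real.logb 2 ((n / 2).factorial : ℝ))|
          ≤ C * (Real.logb 2 n / (n : ℝ) ^ α)) ∧
    (∀ ε : ℝ, 0 < ε → ∃ N : ℕ, ∀ n : ℕ, N ≤ n → Even n →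
      ∀ (V : Type*) [Fintype V] (c : V → Fin 2), IsBalancedBipartition n c →
        1 - 4 * ε <
          ((structureLaw c (p n) (q n)).toOuterMeasure
            {S | |-(1 / (n.choose 2 : ℝ)) * Real.logb 2 (structureLaw c (p n) (q n) S).toReal
                - ((n : ℝ) - 2) / (2 * n - 2) * binaryEntropyBits (p n)
                - (n : ℝ) / (2 * n - 2) * binaryEntropyBits (q n)
                + 2 * Real.logb 2 ((n / 2).factorial : ℝ) / (n.choose 2 : ℝ)|
              < 3 * ε}).toReal) := by
  classical
  constructor
  · obtain ⟨N₁, hN₁⟩ := eventually_of_isLittleO_log_div (fun n => (p n).2.1) hp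
      (show (0 : ℝ) < 72 by norm_num)
    obtain ⟨N₂, hN₂⟩ := eventually_of_isLittleO_log_div (fun n => sub_nonneg.2 (p n).2.2) hp'
      (show (0 : ℝ) < 72 by norm_num)
    -- The error is at most 2/(n ln 2), and log n ≥ 1 is inserted for free. The bound n ≥ 8 gives m
    -- ≥ 4.
    refine ⟨1, one_pos, 2 / Real.log 2, max 8 (max N₁ N₂), fun n hn he V _ c hc => ?_⟩
    have h8 : 8 ≤ n := (le_max_left _ _).trans hn
    have h1 := hN₁ n ((le_max_left _ _).trans ((le_max_right _ _).trans hn)) he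
    have h2 := hN₂ n ((le_max_right _ _).trans ((le_max_right _ _).trans hn)) he
    obtain ⟨m, rfl⟩ := even_iff_exists_two_mul.1 he
    have hA := hc.sum_graphWeight_mul_logb_card_partAut_le (p (2 * m)) (q (2 * m))
      (by omega) rfl h1 h2
    have hA0 : 0 ≤ ∑ G, graphWeight c (p (2 * m)) (q (2 * m)) G
        * Real.logb 2 (partAut c G).card :=
      Finset.sum_nonneg fun G _ => mul_nonneg (graphWeight_nonneg _ _ _ G)
        (Real.logb_nonneg one_lt_two (by exact_mod_cast card_partAut_pos G))
    rw [partitionedStructuralEntropy_eq, hc.sum_binaryEntropyBits, hc.logb_card_partPerms,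
      Nat.mul_div_cancel_left m two_pos, Real.rpow_one]
    have hm2 : ((2 * m : ℕ) : ℝ) ^ 2 / 4 = (m : ℝ) ^ 2 := by
      push_cast
      ring
    rw [hm2, add_sub_cancel_left, abs_of_nonneg hA0]
    refine hA.trans ?_
    have h8' : (8 : ℝ) ≤ (2 * m : ℕ) := by exact_mod_cast h8
    have hlogb : 1 ≤ Real.logb 2 (2 * m : ℕ) := by
      rw [Real.le_logb_iff_rpow_le one_lt_two (by linarith), Real.rpow_one]
      linarith
    have hl := Real.log_pos one_lt_two
    calc 2 / ((2 * m : ℕ) : ℝ) / Real.log 2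
        = 2 / Real.log 2 * (1 / (2 * m : ℕ)) := by ring
      _ ≤ _ := by gcongr
  · intro ε hε
    obtain ⟨N₁, hN₁⟩ := exists_two_mul_logb_factorial_lt hε
    -- This is the Chebyshev threshold for the number of pairs, which is m(2m-1) ≥ m ≥ `N₂`.
    obtain ⟨N₂, hN₂⟩ := exists_nat_gt (8 / Real.log 2 ^ 2 / (16 * ε ^ 3))
    refine ⟨max 2 (max N₁ (2 * N₂)), fun n hn he V _ c hc => ?_⟩
    obtain ⟨m, rfl⟩ := even_iff_exists_two_mul.1 he
    have hm1 : 1 ≤ m := by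
      have := (le_max_left _ _).trans hn
      omega
    have h1 := hN₁ m ((le_max_left _ _).trans ((le_max_right _ _).trans hn))
    have hm2 : N₂ ≤ m := by
      have := (le_max_right _ _).trans ((le_max_right _ _).trans hn)
      omega
    rw [Nat.mul_div_cancel_left m two_pos]
    refine hc.typical (p (2 * m)) (q (2 * m)) hm1 hε h1 ?_
    rw [div_lt_iff₀ (by positivity), mul_comm] at hN₂
    refine hN₂.trans_le ?_
    have hchoose : N₂ ≤ (2 * m).choose 2 := by
      rw [Nat.choose_two_right, mul_assoc, Nat.mul_div_cancel_left _ two_pos]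
      exact hm2.trans (Nat.le_mul_of_pos_right m (by omega))
    gcongr
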